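/- Let $X$ be a compact metric space containing a free interval, that is, an open subset $J\subseteq X$ homeomorphic to the open interval $(0,1)\subseteq\mathbb{R}$. Let $f\colon X\to X$ be a continuous map that is transitive (for all nonempty open $U,V\subseteq X$ there is $k\ge 0$ with $f^k(U)\cap V\ne\emptyset$) and not minimal (some point $x\in X$ has an orbit $\{f^n(x):n\ge 0\}$ that is not dense in $X$). Then: 1. $f$ is relatively mixing: there are $k\ge 1$ and nonempty sets $D_0,\dots,D_{k-1}\subseteq X$, each equal to the closure of its interior, such that $\bigcup_{i} D_i=X$, $f(D_i)\subseteq D_{i+1 \bmod k}$ for all $0\le i<k$, $D_i\cap D_j$ is nowhere dense for all $i\ne j$, and for each $0\le i<k$ the restriction $g=f^k|_{D_i}\colon D_i\to D_i$ is mixing, i.e. for all nonempty relatively open $U,V\subseteq D_i$ there is $N\ge 0$ with $g^n(U)\cap V\neq\emptyset$ for every $n\ge N$; 2. $f$ is not invertible (not a bijection); 3. $f$ has positive topological entropy; 4. the set of periodic points of $f$ (points $x$ with $f^n(x)=x$ for some $n>0$) is dense in $X$. -/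

import Mathlib

namespace FreeInterval

open Set

variable {X : Type*} [TopologicalSpace X]

/-- A free interval of `X`: an open subset homeomorphic to the open interval `(0, 1) ⊆ ℝ`. -/
def IsFreeInterval (J : Set X) : Prop :=
  IsOpen J ∧ Nonempty (J ≃ₜ Ioo (0 : ℝ) 1)

/-- Topological transitivity: for all nonempty open `U`, `V` there is `k ≥ 0` such that
`f^k(U) ∩ V ≠ ∅`. -/
def IsTransitive (f : X → X) : Prop :=
  ∀ U V : Set X, IsOpen U → U.Nonempty → IsOpen V → V.Nonempty →
    ∃ k : ℕ, (f^[k] '' U ∩ V).Nonempty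

/-- The forward orbit `{f^n(x) : n ≥ 0}`. -/
def orbit (f : X → X) (x : X) : Set X :=
  range fun n : ℕ => f^[n] x

/-- `f` is minimal if every point is a transitive point, i.e. has a dense orbit. -/
def IsMinimal (f : X → X) : Prop :=
  ∀ x : X, Dense (orbit f x)

/-- Topological mixing. -/
def IsMixing (f : X → X) : Prop :=
  ∀ U V : Set X, IsOpen U → U.Nonempty → IsOpen V → V.Nonempty →
    ∃ N : ℕ, ∀ n : ℕ, N ≤ n → (f^[n] '' U ∩ V).Nonempty

/-- A regular periodic decomposition `(D_0, …, D_{k-1})` for `f`, of length `k ≥ 1`.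
The addition `i + 1` takes place in `Fin k`, that is, modulo `k`. -/
structure IsRegularPeriodicDecomposition (f : X → X) (k : ℕ) [NeZero k]
    (D : Fin k → Set X) : Prop where
  nonempty : ∀ i, (D i).Nonempty
  regular_closed : ∀ i, D i = closure (interior (D i))
  cover : ⋃ i, D i = univ
  mapsTo : ∀ i, f '' D i ⊆ D (i + 1)
  nowhere_dense_inter : ∀ i j, i ≠ j → IsNowhereDense (D i ∩ D j)

/-- `f` is relatively mixing if for some regular periodic decomposition `(D_0, …, D_{k-1})`
every restriction `f^k|_{D_i} : D_i → D_i` is mixing (for the subspace topology of `D_i`). -/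
def IsRelativelyMixing (f : X → X) : Prop :=
  ∃ (k : ℕ) (_ : NeZero k) (D : Fin k → Set X),
    IsRegularPeriodicDecomposition f k D ∧
      ∀ i, ∃ h : MapsTo f^[k] (D i) (D i), IsMixing (h.restrict f^[k] (D i) (D i))

end FreeInterval

/-!
Parametrize the free interval by an open embedding `e : ℝ → X`. Since `f` is transitive and not
minimal, points with non-dense orbits are dense (`IsTransitive.exists_mem_not_dense_orbit`), so the
free interval contains gaps: intervals `(p, q)` that avoid a closed invariant set `M` containing
their endpoints (`exists_isGap`). A gap behaves like a trap. If an orbit segment of length `n` goes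
from the gap to itself, `f^n` carries the whole component of `(p, q) ∩ f^{-n}(p, q)` around its
starting point into the gap, with the endpoints of the component going to `{p, q}`.

For a suitable gap the preimages of `M` are dense in it (`IsGap.exists_iterate_mem`). Long return
components are therefore short, and the image of any small interval covers the part of the gap on
one side of a prescribed target (`IsGap.exists_branch`). Playing two disjoint intervals against each
other gives both

* dense periodic points, by the intermediate value theorem (`IsGap.exists_mem_periodicPts`), and
* a nonempty open set `V` which is covered by an iterated image of each of its nonempty open subsets
  (`IsGap.exists_isLocallyEventuallyOnto`).

The remaining conclusions follow from the existence of `V`. If `k` is the greatest common divisor of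
the times at which `V` covers itself, all return times of `V` are multiples of `k`, and every open
subset of `V` covers `V` at all large multiples of `k` (`IsLocallyEventuallyOnto.exists_period`). The
closures of the sets of points visiting `V` at times in a fixed residue class modulo `k` then form a
regular periodic decomposition with mixing restrictions. Two separated open subsets of `V` that both
cover `V` at a common time form a horseshoe, which gives positive entropy and non-injectivity.
-/

namespace FreeInterval

open Set

/-! ### Consequences of transitivity -/

section Transitive

variable {X : Type*} [TopologicalSpace X] {f : X → X}

/-- A transitive map of a Hausdorff space with at least two points has dense range: a point `w`
outside the closure of the range could only be reached at time `0`, hence not from an open set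
separated from `w`. -/
theorem IsTransitive.denseRange [T2Space X] [Nontrivial X] (ht : IsTransitive f) :
    DenseRange f := by
  by_contra hd
  obtain ⟨w, hw⟩ : ∃ w, w ∉ closure (range f) := by
    simpa [DenseRange, Dense] using hd
  obtain ⟨y, hy⟩ := exists_ne w
  obtain ⟨u, v, hu, hv, hwu, hyv, huv⟩ := t2_separation hy.symm
  obtain ⟨k, _, ⟨x, hx, rfl⟩, hk⟩ := ht v (u ∩ (closure (range f))ᶜ) hv ⟨y, hyv⟩
    (hu.inter isClosed_closure.isOpen_compl) ⟨w, hwu, hw⟩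
  rcases k with _ | k
  · exact disjoint_left.1 huv hk.1 hx
  · refine hk.2 (subset_closure ?_)
    rw [Function.iterate_succ_apply']
    exact mem_range_self _

theorem denseRange_iterate (hf : Continuous f) (hd : DenseRange f) (n : ℕ) :
    DenseRange f^[n] := by
  induction n with
  | zero => exact Function.surjective_id.denseRange
  | succ n ih =>
    rw [Function.iterate_succ]
    exact ih.comp hd (hf.iterate n)

theorem IsTransitive.exists_iterate_mem_of_le [T2Space X] [Nontrivial X] (ht : IsTransitive f)
    (hf : Continuous f) {U V : Set X} (hU : IsOpen U) (hUn : U.Nonempty) (hV : IsOpen V)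
    (hVn : V.Nonempty) (N : ℕ) : ∃ n, N ≤ n ∧ ∃ x ∈ U, f^[n] x ∈ V := by
  have hVo : IsOpen (f^[N] ⁻¹' V) := hV.preimage (hf.iterate N)
  obtain ⟨y, hy⟩ := (denseRange_iterate hf ht.denseRange N).exists_mem_open hV hVn
  obtain ⟨k, _, ⟨x, hx, rfl⟩, hk⟩ := ht U _ hU hUn hVo ⟨y, hy⟩
  refine ⟨N + k, Nat.le_add_right _ _, x, hx, ?_⟩
  rw [Function.iterate_add_apply]
  exact hk

theorem IsTransitive.eq_univ_of_mapsTo (ht : IsTransitive f) {A : Set X} (hA : IsClosed A)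
    (hm : MapsTo f A A) (hi : (interior A).Nonempty) : A = univ := by
  by_contra hne
  obtain ⟨k, _, ⟨x, hx, rfl⟩, hk⟩ := ht (interior A) Aᶜ isOpen_interior hi hA.isOpen_compl
    (nonempty_compl.2 hne)
  exact hk (hm.iterate k (interior_subset hx))

/-- In a transitive system that is not minimal, the points with a non-dense orbit are dense. If
all points of an open set `V` had dense orbits, then by compactness the points of a closed piece of
`V` would return within a bounded time, so finitely many images of that piece would exhaust `X`. -/
theorem IsTransitive.exists_mem_not_dense_orbit [T2Space X] [Nontrivial X] [CompactSpace X]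
    (ht : IsTransitive f) (hf : Continuous f) (hmin : ¬ IsMinimal f) {V : Set X} (hV : IsOpen V)
    (hVn : V.Nonempty) : ∃ x ∈ V, ¬ Dense (orbit f x) := by
  by_contra! hall
  refine hmin fun y => ?_
  -- The orbit of a point of `V` visits every nonempty open set at arbitrarily late times.
  have hlate : ∀ x ∈ V, ∀ N : ℕ, ∀ O : Set X, IsOpen O → O.Nonempty → ∃ n, f^[N + n] x ∈ O := by
    intro x hx N O hO hOn
    obtain ⟨z, hz⟩ := (denseRange_iterate hf ht.denseRange N).exists_mem_open hO hOn
    obtain ⟨_, hm, n, rfl⟩ := dense_iff_inter_open.1 (hall x hx) _ (hO.preimage (hf.iterate N))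
      ⟨z, hz⟩
    exact ⟨n, by rw [Function.iterate_add_apply]; exact hm⟩
  obtain ⟨x₀, hx₀⟩ := hVn
  obtain ⟨C, hCn, hCc, hCV⟩ := exists_mem_nhds_isClosed_subset (hV.mem_nhds hx₀)
  have hU : (interior C).Nonempty := ⟨x₀, mem_interior_iff_mem_nhds.2 hCn⟩
  obtain ⟨s, hs⟩ := hCc.isCompact.elim_finite_subcover (fun n : ℕ => f^[1 + n] ⁻¹' interior C)
    (fun n => isOpen_interior.preimage (hf.iterate _))
    (fun x hx => mem_iUnion.2 (hlate x (hCV hx) 1 _ isOpen_interior hU))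
  set N := s.sup id with hN
  have hA : (⋃ i ∈ Iic N, f^[i] '' C) = univ := by
    refine ht.eq_univ_of_mapsTo ?_ ?_ ?_
    · exact (finite_Iic N).isClosed_biUnion fun i _ =>
        (hCc.isCompact.image (hf.iterate i)).isClosed
    · intro z hz
      simp only [mem_iUnion, mem_Iic] at hz ⊢
      obtain ⟨i, hi, c, hc, rfl⟩ := hz
      rcases hi.lt_or_eq with hlt | rfl
      · exact ⟨i + 1, hlt, c, hc, Function.iterate_succ_apply' ..⟩
      · obtain ⟨n, hn, hcn⟩ := mem_iUnion₂.1 (hs hc)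
        have hnN : n ≤ N := Finset.le_sup (f := id) hn
        refine ⟨N - n, Nat.sub_le _ _, f^[1 + n] c, interior_subset hcn, ?_⟩
        rw [← Function.iterate_add_apply, ← Function.iterate_succ_apply' f]
        congr 2
        omega
    · refine hU.mono (interior_mono fun c hc => ?_)
      exact mem_iUnion₂.2 ⟨0, Nat.zero_le _, c, hc, rfl⟩
  obtain ⟨i, -, c, hc, rfl⟩ := mem_iUnion₂.1 (hA ▸ mem_univ y)
  refine dense_iff_inter_open.2 fun O hO hOn => ?_
  obtain ⟨n, hn⟩ := hlate c (hCV hc) i O hO hOn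
  refine ⟨_, hn, n, ?_⟩
  change f^[n] (f^[i] c) = _
  rw [← Function.iterate_add_apply, add_comm]

end Transitive

/-! ### Locally eventually onto open sets -/

section LocallyEventuallyOnto

/-- A nonempty open set `V` each of whose nonempty open subsets has an iterated image, at a positive
time, that covers `V`. -/
structure IsLocallyEventuallyOnto {X : Type*} [TopologicalSpace X] (f : X → X) (V : Set X) :
    Prop where
  isOpen : IsOpen V
  nonempty : V.Nonempty
  exists_cover : ∀ U ⊆ V, IsOpen U → U.Nonempty → ∃ n, 0 < n ∧ V ⊆ f^[n] '' U

/-- The points that visit `V` at some time congruent to `-i` modulo `k`. -/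
def visitSet {X : Type*} (f : X → X) (V : Set X) (k i : ℕ) : Set X :=
  {x | ∃ a, f^[a] x ∈ V ∧ k ∣ a + i}

variable {X : Type*} {f : X → X} {V : Set X} {k : ℕ}

theorem visitSet_congr {i j : ℕ} (h : i ≡ j [MOD k]) : visitSet f V k i = visitSet f V k j := by
  ext x
  refine exists_congr fun a => and_congr_right fun _ => ?_
  exact (h.add_left a).dvd_iff dvd_rfl

variable [TopologicalSpace X]

theorem isOpen_visitSet (hf : Continuous f) (hV : IsOpen V) (i : ℕ) :
    IsOpen (visitSet f V k i) := by
  have : visitSet f V k i = ⋃ a ∈ {a | k ∣ a + i}, f^[a] ⁻¹' V := by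
    ext x
    simp [visitSet, and_comm]
  rw [this]
  exact isOpen_biUnion fun a _ => hV.preimage (hf.iterate a)

/-- Let `k` be the greatest common divisor of the times at which `V` covers itself. These times
form an additive monoid, so they contain all large multiples of `k`. Moreover `k` divides every
return time `m` of `V`: if `n ≥ m` is large, `V` is covered at time `n` by the points of `V` that
return at time `m`, so that `n - m` is again a time at which `V` covers itself. -/
theorem IsLocallyEventuallyOnto.exists_period (h : IsLocallyEventuallyOnto f V)
    (hf : Continuous f) : ∃ k, 0 < k ∧ (∀ m, ∀ x ∈ V, f^[m] x ∈ V → k ∣ m) ∧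
      ∀ U ⊆ V, IsOpen U → U.Nonempty → ∃ N, ∀ n, N ≤ n → k ∣ n → V ⊆ f^[n] '' U := by
  let T : AddSubmonoid ℕ :=
    { carrier := {n | V ⊆ f^[n] '' V}
      zero_mem' := by simp
      add_mem' := by
        intro a b ha hb
        change V ⊆ f^[a + b] '' V
        rw [Function.iterate_add, image_comp]
        exact ha.trans (image_mono hb) }
  have hT : ∀ n, n ∈ T ↔ V ⊆ f^[n] '' V := fun _ => Iff.rfl
  set k := Nat.setGcd (T : Set ℕ)
  have hk : ∀ n ∈ T, k ∣ n := fun n hn => Nat.setGcd_dvd_of_mem hn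
  obtain ⟨N₀, hN₀⟩ := Nat.exists_mem_closure_of_ge (T : Set ℕ)
  rw [AddSubmonoid.closure_eq] at hN₀
  have hpos : 0 < k := by
    obtain ⟨n, hn, hVn⟩ := h.exists_cover V Subset.rfl h.isOpen h.nonempty
    exact Nat.pos_of_dvd_of_pos (hk n hVn) hn
  have hlarge : ∀ U ⊆ V, IsOpen U → U.Nonempty →
      ∃ N, ∀ n, N ≤ n → k ∣ n → V ⊆ f^[n] '' U := by
    intro U hUV hU hUn
    obtain ⟨n₀, -, hn₀⟩ := h.exists_cover U hUV hU hUn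
    have hkn₀ : k ∣ n₀ := hk n₀ (hn₀.trans (image_mono hUV))
    refine ⟨n₀ + N₀, fun n hn hkn => ?_⟩
    have hmem : n - n₀ ∈ T := hN₀ _ (by omega) (Nat.dvd_sub hkn hkn₀)
    have hsplit : n = (n - n₀) + n₀ := by omega
    rw [hsplit, Function.iterate_add, image_comp]
    exact ((hT _).1 hmem).trans (image_mono hn₀)
  refine ⟨k, hpos, fun m x hx hmx => ?_, hlarge⟩
  obtain ⟨N, hN⟩ := hlarge (V ∩ f^[m] ⁻¹' V) inter_subset_left
    (h.isOpen.inter (h.isOpen.preimage (hf.iterate m))) ⟨x, hx, hmx⟩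
  have hle : N + m ≤ k * (N + m) := Nat.le_mul_of_pos_left _ hpos
  have hmem : k * (N + m) - m ∈ T := by
    rw [hT]
    intro y hy
    obtain ⟨z, ⟨-, hz⟩, rfl⟩ := hN (k * (N + m)) (by omega) (dvd_mul_right _ _) hy
    refine ⟨f^[m] z, hz, ?_⟩
    rw [← Function.iterate_add_apply]
    congr 2
    omega
  exact (Nat.dvd_sub_iff_right (by omega) (dvd_mul_right _ _)).1 (hk _ hmem)

/-- Any two nonempty open sets are joined by `f^n` for all large `n` in some residue class: pass
from `V` into `U`, and use that the part of `V` arriving in `U` covers `V` at all large multiples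
of `k`. -/
theorem exists_modEq_inter_nonempty (hf : Continuous f) (ht : IsTransitive f) (hV : IsOpen V)
    (hVn : V.Nonempty) (hk : 0 < k)
    (hcov : ∀ U ⊆ V, IsOpen U → U.Nonempty → ∃ N, ∀ n, N ≤ n → k ∣ n → V ⊆ f^[n] '' U)
    {U W : Set X} (hU : IsOpen U) (hUn : U.Nonempty) (hW : IsOpen W) (hWn : W.Nonempty) :
    ∃ r N, ∀ n, N ≤ n → n ≡ r [MOD k] → ∃ x ∈ U, f^[n] x ∈ W := by
  obtain ⟨b, _, ⟨x, hx, rfl⟩, hb⟩ := ht V U hV hVn hU hUn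
  obtain ⟨c, _, ⟨y, hy, rfl⟩, hc⟩ := ht V W hV hVn hW hWn
  obtain ⟨N, hN⟩ := hcov (V ∩ f^[b] ⁻¹' U) inter_subset_left
    (hV.inter (hU.preimage (hf.iterate b))) ⟨x, hx, hb⟩
  refine ⟨c + (k - 1) * b, N + b + c, fun n hn hr => ?_⟩
  have hdvd : k ∣ n + b - c := by
    have h1 : c + 0 ≡ c + (n + b - c) [MOD k] := by
      have h2 : c + (n + b - c) = n + b := by omega
      have h3 : c + (k - 1) * b + b = c + k * b := by
        obtain ⟨k', rfl⟩ : ∃ k', k = k' + 1 := ⟨k - 1, by omega⟩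
        simp only [Nat.add_sub_cancel]
        ring
      rw [h2]
      refine ((hr.add_right b).trans ?_).symm
      rw [h3]
      exact Nat.ModEq.add_left c ((Nat.modEq_zero_iff_dvd).2 (dvd_mul_right k b))
    exact (Nat.modEq_zero_iff_dvd).1 (Nat.ModEq.add_left_cancel' c h1).symm
  obtain ⟨z, ⟨-, hz⟩, hzy⟩ := hN (n + b - c) (by omega) hdvd hy
  refine ⟨f^[b] z, hz, ?_⟩
  rw [← Function.iterate_add_apply, show n + b = c + (n + b - c) by omega,
    Function.iterate_add_apply, hzy]
  exact hc

theorem mapsTo_closure_visitSet (hf : Continuous f) (hV : IsOpen V)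
    (hcov : ∀ U ⊆ V, IsOpen U → U.Nonempty → ∃ N, ∀ n, N ≤ n → k ∣ n → V ⊆ f^[n] '' U)
    (hk : 0 < k) (i : ℕ) :
    MapsTo f (closure (visitSet f V k i)) (closure (visitSet f V k (i + 1))) := by
  refine MapsTo.closure_left ?_ hf isClosed_closure
  rintro x ⟨a, ha, hka⟩
  rcases a with _ | a
  · -- A point of `V` may fail to come back to `V`, but it is a limit of points that do.
    refine mem_closure_iff.2 fun O hO hxO => ?_
    obtain ⟨N, hN⟩ := hcov (V ∩ f ⁻¹' O) inter_subset_left (hV.inter (hO.preimage hf)) ⟨x, ha, hxO⟩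
    obtain ⟨z, ⟨-, hz⟩, hzx⟩ := hN (k * (N + 1)) (by nlinarith) (dvd_mul_right _ _) ha
    refine ⟨f z, hz, k * (N + 1) - 1, ?_, ?_⟩
    · rw [← Function.iterate_succ_apply, Nat.sub_one, Nat.succ_pred (by positivity), hzx]
      exact ha
    · have : 0 < k * (N + 1) := by positivity
      rw [show k * (N + 1) - 1 + (i + 1) = k * (N + 1) + (0 + i) by omega]
      exact dvd_add (dvd_mul_right _ _) hka
  · refine subset_closure ⟨a, ha, ?_⟩
    rwa [show a + (i + 1) = a + 1 + i by omega]

theorem IsLocallyEventuallyOnto.isRelativelyMixing (h : IsLocallyEventuallyOnto f V)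
    (hf : Continuous f) (ht : IsTransitive f) : IsRelativelyMixing f := by
  obtain ⟨k, hk, hret, hcov⟩ := h.exists_period hf
  have : NeZero k := ⟨hk.ne'⟩
  let E : ℕ → Set X := visitSet f V k
  have hEo : ∀ i, IsOpen (E i) := isOpen_visitSet hf h.isOpen
  have hmaps : ∀ i, MapsTo f (closure (E i)) (closure (E (i + 1))) :=
    mapsTo_closure_visitSet hf h.isOpen hcov hk
  have hmapsIter : ∀ j i, MapsTo f^[j] (closure (E i)) (closure (E (i + j))) := by
    intro j
    induction j with
    | zero => exact fun i => mapsTo_id _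
    | succ j ih =>
      intro i
      rw [Function.iterate_succ']
      exact (hmaps (i + j)).comp (ih i)
  -- The times at which a given point visits `V` are congruent modulo `k`.
  have hvisit : ∀ x s t, f^[s] x ∈ V → f^[t] x ∈ V → s ≡ t [MOD k] := by
    have hle : ∀ x s t, s ≤ t → f^[s] x ∈ V → f^[t] x ∈ V → s ≡ t [MOD k] := by
      intro x s t hst hs hxt
      refine (Nat.modEq_iff_dvd' hst).2 (hret _ _ hs ?_)
      rwa [← Function.iterate_add_apply, Nat.sub_add_cancel hst]
    intro x s t hs hxt
    rcases le_total s t with hst | hst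
    · exact hle x s t hst hs hxt
    · exact (hle x t s hst hxt hs).symm
  refine ⟨k, this, fun i => closure (E i), ?_, fun i => ?_⟩
  · refine ⟨fun i => ?_, fun i => ?_, ?_, fun i => ?_, fun i j hij => ?_⟩
    · refine Nonempty.mono subset_closure ?_
      obtain ⟨N, hN⟩ := hcov V Subset.rfl h.isOpen h.nonempty
      obtain ⟨y, hy⟩ := h.nonempty
      have hle : N + i ≤ k * (N + i) := Nat.le_mul_of_pos_left _ hk
      obtain ⟨x, -, rfl⟩ := hN (k * (N + i)) (by omega) (dvd_mul_right _ _) hy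
      refine ⟨f^[i] x, k * (N + i) - i, ?_, ?_⟩
      · rwa [← Function.iterate_add_apply, Nat.sub_add_cancel (by omega)]
      · rw [Nat.sub_add_cancel (by omega)]
        exact dvd_mul_right _ _
    · refine Subset.antisymm (closure_mono ?_) ?_
      · exact interior_maximal subset_closure (hEo i)
      · exact closure_minimal interior_subset isClosed_closure
    · rw [← closure_iUnion_of_finite, ← dense_iff_closure_eq, dense_iff_inter_open]
      intro O hO hOn
      obtain ⟨n, _, ⟨x, hx, rfl⟩, hn⟩ := ht O V hO hOn h.isOpen h.nonempty
      refine ⟨x, hx, mem_iUnion.2 ⟨⟨((k - 1) * n) % k, Nat.mod_lt _ hk⟩, n, hn, ?_⟩⟩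
      refine ((Nat.mod_modEq ((k - 1) * n) k).add_left n).dvd_iff dvd_rfl |>.2 ?_
      obtain ⟨k', rfl⟩ : ∃ k', k = k' + 1 := ⟨k - 1, by omega⟩
      exact ⟨n, by simp only [Nat.add_sub_cancel]; ring⟩
    · have hEi : E ((i + 1 : Fin k) : ℕ) = E (i + 1) := by
        refine visitSet_congr ?_
        rw [Fin.val_add, Fin.val_one', Nat.ModEq, Nat.mod_mod, Nat.add_mod_mod]
      rw [hEi]
      exact (hmaps i).image_subset
    · rw [IsNowhereDense, (isClosed_closure.inter isClosed_closure).closure_eq,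
        eq_empty_iff_forall_notMem]
      intro y hy
      -- A common interior point would give a common point of the disjoint sets `E i` and `E j`.
      obtain ⟨z, hz, hzi⟩ := mem_closure_iff.1 (interior_subset hy).1 _ isOpen_interior hy
      obtain ⟨x, hx, hxj⟩ := mem_closure_iff.1 (interior_subset hz).2 _ (hEo i) hzi
      obtain ⟨a, ha, hai⟩ := hx
      obtain ⟨b, hb, hbj⟩ := hxj
      have h1 : a + i ≡ a + j [MOD k] :=
        ((Nat.modEq_zero_iff_dvd.2 hai).trans (Nat.modEq_zero_iff_dvd.2 hbj).symm).trans
          ((hvisit x b a hb ha).add_right j)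
      exact hij (Fin.ext ((Nat.ModEq.add_left_cancel' a h1).eq_of_lt_of_lt i.2 j.2))
  · have hm : MapsTo f^[k] (closure (E i)) (closure (E i)) := by
      have h1 := hmapsIter k i
      rwa [show E (i + k) = E i from visitSet_congr (by simp [Nat.ModEq])] at h1
    refine ⟨hm, fun U' W' hU' hUn hW' hWn => ?_⟩
    obtain ⟨U, hU, rfl⟩ := isOpen_induced_iff.1 hU'
    obtain ⟨W, hW, rfl⟩ := isOpen_induced_iff.1 hW'
    obtain ⟨⟨u, hu⟩, huU⟩ := hUn
    obtain ⟨⟨w, hw⟩, hwW⟩ := hWn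
    obtain ⟨r, N, hN⟩ := exists_modEq_inter_nonempty hf ht h.isOpen h.nonempty hk hcov
      (hU.inter (hEo i)) (mem_closure_iff.1 hu U hU huU)
      (hW.inter (hEo i)) (mem_closure_iff.1 hw W hW hwW)
    -- The residue class is that of `0`, since `f^n` sends a point of `E i` to `E i`.
    have hr : r ≡ 0 [MOD k] := by
      have hn : N ≤ r + k * N := le_add_left (Nat.le_mul_of_pos_left _ hk)
      have hnr : r + k * N ≡ r [MOD k] := by simp [Nat.ModEq]
      obtain ⟨x, ⟨-, a, ha, hai⟩, -, b, hb, hbi⟩ := hN _ hn hnr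
      rw [← Function.iterate_add_apply] at hb
      have h1 : a + i ≡ b + i [MOD k] :=
        (Nat.modEq_zero_iff_dvd.2 hai).trans (Nat.modEq_zero_iff_dvd.2 hbi).symm
      have h2 : b + (r + k * N) ≡ b + 0 [MOD k] :=
        (hvisit x _ _ hb ha).trans (Nat.ModEq.add_right_cancel' _ h1)
      exact hnr.symm.trans (Nat.ModEq.add_left_cancel' b h2)
    refine ⟨N, fun n hn => ?_⟩
    obtain ⟨x, ⟨hxU, hxE⟩, hxW, -⟩ := hN (k * n) (hn.trans (Nat.le_mul_of_pos_left _ hk))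
      ((Nat.modEq_zero_iff_dvd.2 (dvd_mul_right k n)).trans hr.symm)
    refine ⟨_, ⟨⟨x, subset_closure hxE⟩, hxU, rfl⟩, ?_⟩
    rw [MapsTo.iterate_restrict]
    change (f^[k])^[n] x ∈ W
    rwa [← Function.iterate_mul]

end LocallyEventuallyOnto

/-! ### Horseshoes -/

section Horseshoe

theorem exists_itinerary {X : Type*} {f : X → X} {V : Set X} (hVn : V.Nonempty) {n : ℕ}
    {U : Bool → Set X} (hUV : ∀ s, U s ⊆ V) (hcov : ∀ s, V ⊆ f^[n] '' U s) (j : ℕ) :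
    ∀ w : ℕ → Bool, ∃ x ∈ V, ∀ i < j, f^[n * i] x ∈ U (w i) := by
  induction j with
  | zero =>
    obtain ⟨x, hx⟩ := hVn
    exact fun w => ⟨x, hx, by simp⟩
  | succ j ih =>
    intro w
    obtain ⟨y, hy, hyw⟩ := ih fun i => w (i + 1)
    obtain ⟨x, hx, rfl⟩ := hcov (w 0) hy
    refine ⟨x, hUV _ hx, fun i hi => ?_⟩
    rcases i with _ | i
    · exact hx
    · have := hyw i (by omega)
      rwa [← Function.iterate_add_apply] at this

/-- If two sets at positive distance both cover their union under `f^n`, then there are `2 ^ j`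
orbit segments of length `n * j` that are pairwise separated, so the entropy is at least
`log 2 / n`. -/
theorem coverEntropy_pos_of_horseshoe {X : Type*} [PseudoMetricSpace X] {f : X → X} {V : Set X}
    (hVn : V.Nonempty) {n : ℕ} (hn : 0 < n) {U : Bool → Set X} (hUV : ∀ s, U s ⊆ V)
    (hcov : ∀ s, V ⊆ f^[n] '' U s) {δ : ℝ} (hδ : 0 < δ)
    (hsep : ∀ x ∈ U false, ∀ y ∈ U true, 2 * δ ≤ dist x y) :
    0 < Dynamics.coverEntropy f univ := by
  classical
  have hmem : {p : X × X | dist p.1 p.2 < δ} ∈ uniformity X := Metric.dist_mem_uniformity hδ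
  refine lt_of_lt_of_le ?_ (Dynamics.netEntropyEntourage_le_coverEntropy f univ hmem)
  have hcard : ∀ j : ℕ, (2 ^ j : ℕ∞) ≤
      Dynamics.netMaxcard f univ {p : X × X | dist p.1 p.2 < δ} (n * j) := by
    intro j
    choose x _ hxw using exists_itinerary hVn hUV hcov j
    let ext' : (Fin j → Bool) → ℕ → Bool := fun w i => if h : i < j then w ⟨i, h⟩ else false
    have hx : ∀ (w : Fin j → Bool) (i : Fin j), f^[n * i] (x (ext' w)) ∈ U (w i) := by
      intro w i
      have := hxw (ext' w) i i.2
      simpa [ext'] using this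
    have hdist : ∀ (w w' : Fin j → Bool) (i : Fin j), w i ≠ w' i →
        2 * δ ≤ dist (f^[n * i] (x (ext' w))) (f^[n * i] (x (ext' w'))) := by
      intro w w' i hi
      have h1 := hx w i
      have h2 := hx w' i
      cases hwi : w i <;> cases hwi' : w' i <;> rw [hwi] at h1 <;> rw [hwi'] at h2
      · exact absurd (hwi.trans hwi'.symm) hi
      · exact hsep _ h1 _ h2
      · rw [dist_comm]
        exact hsep _ h2 _ h1
      · exact absurd (hwi.trans hwi'.symm) hi
    have hinj : Function.Injective fun w : Fin j → Bool => x (ext' w) := by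
      intro w w' hww
      by_contra hne
      obtain ⟨i, hi⟩ := Function.ne_iff.1 hne
      have := hdist w w' i hi
      simp only at hww
      rw [hww, dist_self] at this
      linarith
    have hnet : Dynamics.IsDynNetIn f univ {p : X × X | dist p.1 p.2 < δ} (n * j)
        ((Finset.univ.image fun w : Fin j → Bool => x (ext' w) : Finset X) : Set X) := by
      refine ⟨subset_univ _, ?_⟩
      intro a ha b hb hab
      simp only [Finset.coe_image, Finset.coe_univ, image_univ, mem_range] at ha hb
      obtain ⟨w, rfl⟩ := ha
      obtain ⟨w', rfl⟩ := hb
      obtain ⟨i, hi⟩ : ∃ i, w i ≠ w' i := by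
        by_contra! hcon
        exact hab (by rw [funext hcon])
      refine disjoint_left.2 fun z hz hz' => ?_
      have hlt : n * i < n * j := Nat.mul_lt_mul_of_pos_left i.2 hn
      have h1 : dist (f^[n * i] (x (ext' w))) (f^[n * i] z) < δ :=
        Dynamics.mem_ball_dynEntourage.1 hz _ hlt
      have h2 : dist (f^[n * i] (x (ext' w'))) (f^[n * i] z) < δ :=
        Dynamics.mem_ball_dynEntourage.1 hz' _ hlt
      have h3 := dist_triangle_right (f^[n * i] (x (ext' w))) (f^[n * i] (x (ext' w')))
        (f^[n * i] z)
      linarith [hdist w w' i hi]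
    have := hnet.card_le_netMaxcard
    rw [Finset.card_image_of_injective _ hinj] at this
    simpa using this
  have hpos : (0 : EReal) < ((Real.log 2 / n : ℝ) : EReal) := by
    exact_mod_cast div_pos (Real.log_pos one_lt_two) (Nat.cast_pos.2 hn)
  refine lt_of_lt_of_le hpos (Frequently.le_expGrowthSup ?_)
  refine Filter.frequently_atTop.2 fun m => ⟨n * m, Nat.le_mul_of_pos_left _ hn, ?_⟩
  have hexp : EReal.exp (((Real.log 2 / n : ℝ) : EReal) * ((n * m : ℕ) : EReal)) = 2 ^ m := by
    have h1 : ((Real.log 2 / n : ℝ) : EReal) * ((n * m : ℕ) : EReal)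
        = ((Real.log 2 * m : ℝ) : EReal) := by
      rw [← EReal.coe_natCast, ← EReal.coe_mul]
      congr 1
      have : (n : ℝ) ≠ 0 := by positivity
      push_cast
      field_simp
    rw [h1, EReal.exp_coe, mul_comm, Real.exp_nat_mul, Real.exp_log two_pos,
      ENNReal.ofReal_pow two_pos.le]
    simp
  rw [hexp]
  have := ENat.toENNReal_mono (hcard m)
  simpa using this

variable {X : Type*} [MetricSpace X] {f : X → X} {V : Set X}

/-- A locally eventually onto set with two points carries a horseshoe: two separated open subsets
that both cover the whole set at a common time. -/
theorem IsLocallyEventuallyOnto.exists_horseshoe (h : IsLocallyEventuallyOnto f V)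
    (hf : Continuous f) (hV : V.Nontrivial) : ∃ n, 0 < n ∧ ∃ U : Bool → Set X, ∃ δ > 0,
      (∀ s, U s ⊆ V) ∧ (∀ s, V ⊆ f^[n] '' U s) ∧
        ∀ x ∈ U false, ∀ y ∈ U true, 2 * δ ≤ dist x y := by
  obtain ⟨k, hk, -, hcov⟩ := h.exists_period hf
  obtain ⟨a, ha, b, hb, hab⟩ := hV
  have hd : 0 < dist a b := dist_pos.2 hab
  let δ := dist a b / 4
  have hδ : 0 < δ := by positivity
  obtain ⟨N, hN⟩ := hcov (V ∩ Metric.ball a δ) inter_subset_left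
    (h.isOpen.inter Metric.isOpen_ball) ⟨a, ha, Metric.mem_ball_self hδ⟩
  obtain ⟨N', hN'⟩ := hcov (V ∩ Metric.ball b δ) inter_subset_left
    (h.isOpen.inter Metric.isOpen_ball) ⟨b, hb, Metric.mem_ball_self hδ⟩
  have hle : N + N' + 1 ≤ k * (N + N' + 1) := Nat.le_mul_of_pos_left _ hk
  refine ⟨k * (N + N' + 1), by omega,
    fun s => if s then V ∩ Metric.ball b δ else V ∩ Metric.ball a δ, δ, hδ, ?_, ?_, ?_⟩
  · intro s
    cases s <;> simp
  · intro s
    cases s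
    · simpa using hN _ (by omega) (dvd_mul_right _ _)
    · simpa using hN' _ (by omega) (dvd_mul_right _ _)
  · simp only [Bool.false_eq_true, if_false, if_true]
    rintro x ⟨-, hx⟩ y ⟨-, hy⟩
    rw [Metric.mem_ball] at hx hy
    have h1 := dist_triangle4 a x y b
    rw [dist_comm a x] at h1
    have h2 : dist a b = 4 * δ := by simp only [δ]; ring
    linarith

theorem IsLocallyEventuallyOnto.coverEntropy_pos (h : IsLocallyEventuallyOnto f V)
    (hf : Continuous f) (hV : V.Nontrivial) : 0 < Dynamics.coverEntropy f univ := by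
  obtain ⟨n, hn, U, δ, hδ, hUV, hcov, hsep⟩ := h.exists_horseshoe hf hV
  exact coverEntropy_pos_of_horseshoe h.nonempty hn hUV hcov hδ hsep

theorem IsLocallyEventuallyOnto.not_injective (h : IsLocallyEventuallyOnto f V)
    (hf : Continuous f) (hV : V.Nontrivial) : ¬ Function.Injective f := by
  obtain ⟨n, hn, U, δ, hδ, hUV, hcov, hsep⟩ := h.exists_horseshoe hf hV
  obtain ⟨y, hy⟩ := h.nonempty
  obtain ⟨x, hx, hxy⟩ := hcov false hy
  obtain ⟨x', hx', rfl⟩ := hcov true hy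
  intro hinj
  have := hsep x hx x' hx'
  rw [hinj.iterate n hxy, dist_self] at this
  linarith

end Horseshoe

/-! ### Complementary intervals of closed invariant sets -/

section Gap

open Topology

/-- With the free interval parametrized by `e : ℝ → X`, the interval `(p, q)` is a bounded component
of the complement of a closed invariant set `M`. -/
structure IsGap {X : Type*} [TopologicalSpace X] (f : X → X) (e : ℝ → X) (M : Set X) (p q : ℝ) :
    Prop where
  lt : p < q
  isClosed : IsClosed M
  mapsTo : MapsTo f M M
  left_mem : e p ∈ M
  right_mem : e q ∈ M
  notMem : ∀ t ∈ Ioo p q, e t ∉ M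

theorem exists_Ioo_disjoint_of_isClosed {S : Set ℝ} (hS : IsClosed S) {a b m : ℝ} (ha : a ∈ S)
    (hb : b ∈ S) (ham : a < m) (hmb : m < b) (hm : m ∉ S) :
    ∃ p q, a ≤ p ∧ p < q ∧ q ≤ b ∧ p ∈ S ∧ q ∈ S ∧ ∀ t ∈ Ioo p q, t ∉ S := by
  obtain ⟨p, ⟨hpS, hp⟩, hpmax⟩ := (isCompact_Icc.inter_left hS).exists_isGreatest
    (⟨a, ha, le_rfl, ham.le⟩ : (S ∩ Icc a m).Nonempty)
  obtain ⟨q, ⟨hqS, hq⟩, hqmin⟩ := (isCompact_Icc.inter_left hS).exists_isLeast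
    (⟨b, hb, hmb.le, le_rfl⟩ : (S ∩ Icc m b).Nonempty)
  have hpm : p < m := hp.2.lt_of_ne fun h => hm (h ▸ hpS)
  have hmq : m < q := hq.1.lt_of_ne fun h => hm (h.symm ▸ hqS)
  refine ⟨p, q, hp.1, hpm.trans hmq, hq.2, hpS, hqS, fun t ht htS => ?_⟩
  rcases le_total t m with h | h
  · exact absurd (hpmax ⟨htS, hp.1.trans ht.1.le, h⟩) (not_le.2 ht.1)
  · exact absurd (hqmin ⟨htS, h, ht.2.le.trans hq.2⟩) (not_le.2 ht.2)

variable {X : Type*} [TopologicalSpace X] {f : X → X} {e : ℝ → X}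

/-- An iterate that sends `e '' A` into `e '' B` lifts to a continuous real function on `A`. -/
theorem exists_lift (he : IsEmbedding e) (hf : Continuous f) {A B : Set ℝ} {n : ℕ}
    (h : ∀ t ∈ A, f^[n] (e t) ∈ e '' B) :
    ∃ g : ℝ → ℝ, ContinuousOn g A ∧ ∀ t ∈ A, g t ∈ B ∧ f^[n] (e t) = e (g t) := by
  choose! g hgB hg using h
  refine ⟨g, ?_, fun t ht => ⟨hgB t ht, (hg t ht).symm⟩⟩
  rw [he.isInducing.continuousOn_iff]
  exact ((hf.iterate n).comp he.continuous).continuousOn.congr fun t ht => hg t ht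

variable [T2Space X] [Nontrivial X]

/-- The endpoints of the gap come from two points with non-dense orbits; the union `M` of their orbit
closures is nowhere dense, as a closed invariant set with interior is everything. -/
theorem exists_isGap [CompactSpace X] (he : IsOpenEmbedding e) (hf : Continuous f) (ht : IsTransitive f)
    (hmin : ¬ IsMinimal f) {a b : ℝ} (hab : a < b) :
    ∃ M p q, a ≤ p ∧ q ≤ b ∧ IsGap f e M p q := by
  have hIoo : ∀ {c d : ℝ}, c < d → ∃ t ∈ Ioo c d, ¬ Dense (orbit f (e t)) := by
    intro c d hcd
    obtain ⟨_, ⟨t, ht', rfl⟩, hx⟩ := ht.exists_mem_not_dense_orbit hf hmin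
      (he.isOpenMap _ isOpen_Ioo) ((nonempty_Ioo.2 hcd).image e)
    exact ⟨t, ht', hx⟩
  have hmapsTo : ∀ x, MapsTo f (closure (orbit f x)) (closure (orbit f x)) := by
    refine fun x => MapsTo.closure ?_ hf
    rintro _ ⟨n, rfl⟩
    exact ⟨n + 1, Function.iterate_succ_apply' ..⟩
  have hself : ∀ x, x ∈ closure (orbit f x) := fun x => subset_closure ⟨0, rfl⟩
  have hint : ∀ x, ¬ Dense (orbit f x) → interior (closure (orbit f x)) = ∅ := by
    intro x hx
    by_contra hne
    exact hx (dense_iff_closure_eq.2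
      (ht.eq_univ_of_mapsTo isClosed_closure (hmapsTo x) (nonempty_iff_ne_empty.2 hne)))
  obtain ⟨s, hs, hsd⟩ := hIoo (show a < (a + b) / 2 by linarith)
  obtain ⟨u, hu, hud⟩ := hIoo (show (a + b) / 2 < b by linarith)
  set M := closure (orbit f (e s)) ∪ closure (orbit f (e u)) with hM
  have hMc : IsClosed M := isClosed_closure.union isClosed_closure
  have hMi : interior M = ∅ := by
    rw [hM, interior_union_isClosed_of_interior_empty isClosed_closure (hint _ hud), hint _ hsd]
  have hsu : s < u := hs.2.trans hu.1
  obtain ⟨m, hm, hmM⟩ : ∃ m ∈ Ioo s u, e m ∉ M := by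
    by_contra! hcon
    have hsub : e '' Ioo s u ⊆ interior M :=
      interior_maximal (image_subset_iff.2 hcon) (he.isOpenMap _ isOpen_Ioo)
    rw [hMi] at hsub
    exact ((nonempty_Ioo.2 hsu).image e).ne_empty (subset_empty_iff.1 hsub)
  obtain ⟨p, q, hsp, hpq, hqu, hp, hq, hno⟩ := exists_Ioo_disjoint_of_isClosed
    (hMc.preimage he.continuous) (Or.inl (hself _)) (Or.inr (hself _)) hm.1 hm.2 hmM
  refine ⟨M, p, q, hs.1.le.trans hsp, hqu.trans hu.2.le, hpq, hMc, ?_, hp, hq, hno⟩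
  exact fun x hx => hx.imp (fun h => hmapsTo _ h) fun h => hmapsTo _ h

variable {M : Set X} {p q : ℝ}

/-- The preimages of `M` are dense in a gap that either contains no periodic point or is avoided by
some periodic orbit. Otherwise an open interval `O` of the gap never meets `M`; if `f^l(O)` meets
`O`, the union of the `f^{lj}(O)` is connected and avoids `M`, so it stays in the gap. Its closure
is an interval mapped into itself by `f^l`, which gives a fixed point of `f^l`, and finitely many
images of that interval cover `X`, so that it meets every periodic orbit. -/
theorem IsGap.exists_iterate_mem [CompactSpace X] (hG : IsGap f e M p q)
    (he : IsOpenEmbedding e) (hf : Continuous f) (ht : IsTransitive f)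
    (hper : (∀ t ∈ Icc p q, e t ∉ Function.periodicPts f) ∨
      ∃ z ∈ Function.periodicPts f, ∀ n, f^[n] z ∉ e '' Icc p q)
    {a b : ℝ} (hpa : p ≤ a) (hab : a < b) (hbq : b ≤ q) :
    ∃ t ∈ Ioo a b, ∃ n, f^[n] (e t) ∈ M := by
  by_contra! hno
  set O := e '' Ioo a b with hO
  have hOo : IsOpen O := he.isOpenMap _ isOpen_Ioo
  have hOn : O.Nonempty := (nonempty_Ioo.2 hab).image e
  obtain ⟨l, hl, x₀, hx₀, hx₀l⟩ := ht.exists_iterate_mem_of_le hf hOo hOn hOo hOn 1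
  set C := ⋃ j, f^[l * j] '' O with hC
  have hOC : O ⊆ C := fun x hx => mem_iUnion.2 ⟨0, x, hx, rfl⟩
  have hCmaps : MapsTo f^[l] C C := by
    intro y hy
    obtain ⟨j, x, hx, rfl⟩ := mem_iUnion.1 hy
    refine mem_iUnion.2 ⟨j + 1, x, hx, ?_⟩
    rw [← Function.iterate_add_apply]
    congr 2
    ring
  have hCconn : IsPreconnected C := by
    refine IsPreconnected.iUnion_of_chain (fun j => ?_) fun j => ?_
    · exact (isPreconnected_Ioo.image e he.continuous.continuousOn).image _
        (hf.iterate _).continuousOn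
    · refine ⟨f^[l * j] (f^[l] x₀), ⟨_, hx₀l, rfl⟩, x₀, hx₀, ?_⟩
      rw [← Function.iterate_add_apply]
      congr 2
  have hCM : ∀ y ∈ C, y ∉ M := by
    intro y hy
    obtain ⟨j, _, ⟨t, ht', rfl⟩, rfl⟩ := mem_iUnion.1 hy
    exact hno t ht' _
  have hcl : IsClosed (e '' Icc p q) := (isCompact_Icc.image he.continuous).isClosed
  have hCgap : C ⊆ e '' Ioo p q := by
    refine hCconn.subset_left_of_subset_union (he.isOpenMap _ isOpen_Ioo) hcl.isOpen_compl
      ?_ ?_ ?_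
    · exact disjoint_compl_right.mono_left (image_mono Ioo_subset_Icc_self)
    · intro y hy
      by_cases hyI : y ∈ e '' Icc p q
      · obtain ⟨t, ht', rfl⟩ := hyI
        refine Or.inl ⟨t, ⟨ht'.1.lt_of_ne ?_, ht'.2.lt_of_ne ?_⟩, rfl⟩
        · rintro rfl
          exact hCM _ hy hG.left_mem
        · rintro rfl
          exact hCM _ hy hG.right_mem
      · exact Or.inr hyI
    · obtain ⟨_, t, ht', rfl⟩ := hOn
      exact ⟨_, hOC ⟨t, ht', rfl⟩, t, ⟨hpa.trans_lt ht'.1, ht'.2.trans_le hbq⟩, rfl⟩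
  have hCIcc : closure C ⊆ e '' Icc p q :=
    closure_minimal (hCgap.trans (image_mono Ioo_subset_Icc_self)) hcl
  have hclmaps : MapsTo f^[l] (closure C) (closure C) := hCmaps.closure (hf.iterate l)
  rcases hper with hper | ⟨z, hz, hzno⟩
  · -- The closure of `C` is a compact interval, so `f^l` has a fixed point there.
    have hconn : IsConnected (e ⁻¹' closure C) := by
      have hclconn : IsConnected (closure C) :=
        ⟨hOn.mono (hOC.trans subset_closure), hCconn.closure⟩
      exact hclconn.preimage_of_isOpenMap he.injective he.isOpenMap
        (hCIcc.trans (image_subset_range _ _))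
    have hcomp : IsCompact (e ⁻¹' closure C) :=
      isCompact_Icc.of_isClosed_subset (isClosed_closure.preimage he.continuous) fun t ht' => by
        obtain ⟨t', h1, h2⟩ := hCIcc ht'
        rwa [← he.injective h2]
    obtain ⟨g, hgc, hg⟩ := exists_lift (n := l) he.isEmbedding hf (A := e ⁻¹' closure C)
      (B := e ⁻¹' closure C) fun t ht' => by
        have h1 := hclmaps ht'
        obtain ⟨t', -, h2⟩ := hCIcc h1
        exact ⟨t', by rwa [mem_preimage, h2], h2⟩
    have hIcc := eq_Icc_of_connected_compact hconn hcomp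
    rw [hIcc] at hgc hg hconn
    obtain ⟨c, hc, hfix⟩ := exists_mem_Icc_isFixedPt_of_mapsTo hgc
      (nonempty_Icc.1 hconn.nonempty) fun t ht' => (hg t ht').1
    have hcC : e c ∈ closure C := by
      have : c ∈ e ⁻¹' closure C := hIcc ▸ hc
      exact this
    obtain ⟨c', hc', hcc'⟩ := hCIcc hcC
    rw [he.injective hcc'] at hc'
    refine hper c hc' ⟨l, hl, ?_⟩
    rw [Function.IsPeriodicPt, Function.IsFixedPt, (hg c hc).2, hfix]
  · have huniv : (⋃ i ∈ Iio l, f^[i] '' closure C) = univ := by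
      refine ht.eq_univ_of_mapsTo ?_ ?_ ?_
      · exact (finite_Iio l).isClosed_biUnion fun i _ =>
          (isClosed_closure.isCompact.image (hf.iterate i)).isClosed
      · intro y hy
        simp only [mem_iUnion, mem_Iio] at hy ⊢
        obtain ⟨i, hi, c, hc, rfl⟩ := hy
        by_cases hil : i + 1 < l
        · exact ⟨i + 1, hil, c, hc, Function.iterate_succ_apply' ..⟩
        · refine ⟨0, hl, f^[l] c, hclmaps hc, ?_⟩
          rw [show l = i + 1 by omega, Function.iterate_succ_apply']
          rfl
      · refine hOn.mono (interior_maximal (fun y hy => ?_) hOo)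
        exact mem_iUnion₂.2 ⟨0, hl, y, subset_closure (hOC hy), rfl⟩
    obtain ⟨i, hi, c, hc, rfl⟩ := mem_iUnion₂.1 (huniv ▸ mem_univ z)
    refine hzno (l - i) (hCIcc ?_)
    rw [← Function.iterate_add_apply, Nat.sub_add_cancel (le_of_lt hi)]
    exact hclmaps hc

/-! ### Branches of return maps -/

/-- A piece `[s, u]` of `(a, b)` which some iterate of `f` maps into the closed gap `[p, q]`, from an
endpoint of the gap to a prescribed target `(c, d)`. Some `w ∈ (a, b)` falls into `M`, while between
`w` and `b` some `u` reaches the target at a later time `n`; going left from `u`, the point `s` is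
where `f^n` first leaves the open gap. -/
theorem IsGap.exists_branch (hG : IsGap f e M p q) (he : IsOpenEmbedding e)
    (hf : Continuous f) (ht : IsTransitive f)
    (hpre : ∀ a b, p ≤ a → a < b → b ≤ q → ∃ t ∈ Ioo a b, ∃ n, f^[n] (e t) ∈ M)
    {a b c d : ℝ} (hpa : p ≤ a) (hab : a < b) (hbq : b ≤ q) (hpc : p ≤ c) (hcd : c < d)
    (hdq : d ≤ q) :
    ∃ n, 0 < n ∧ ∃ s u, ∃ g : ℝ → ℝ, a < s ∧ s < u ∧ u < b ∧ ContinuousOn g (Icc s u) ∧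
      (∀ t ∈ Icc s u, f^[n] (e t) = e (g t)) ∧ g u ∈ Ioo c d ∧ (g s = p ∨ g s = q) := by
  obtain ⟨w, hw, i, hi⟩ := hpre a b hpa hab hbq
  obtain ⟨n, hn, _, ⟨u, hu, rfl⟩, hun⟩ := ht.exists_iterate_mem_of_le hf
    (he.isOpenMap _ isOpen_Ioo) ((nonempty_Ioo.2 hw.2).image e)
    (he.isOpenMap _ isOpen_Ioo) ((nonempty_Ioo.2 hcd).image e) (i + 1)
  have hwM : f^[n] (e w) ∈ M := by
    rw [show n = (n - i) + i by omega, Function.iterate_add_apply]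
    exact hG.mapsTo.iterate _ hi
  have hgapM : ∀ x ∈ M, x ∉ e '' Ioo p q := by
    rintro _ hx ⟨t, ht', rfl⟩
    exact hG.notMem t ht' hx
  have hgo : IsOpen (e '' Ioo p q) := he.isOpenMap _ isOpen_Ioo
  have hcont : Continuous fun t => f^[n] (e t) := (hf.iterate n).comp he.continuous
  have hcl : IsClosed (e '' Icc p q) := (isCompact_Icc.image he.continuous).isClosed
  have hugap : f^[n] (e u) ∈ e '' Ioo p q := image_mono (Ioo_subset_Ioo hpc hdq) hun
  obtain ⟨s, ⟨hsS, hs⟩, hsmax⟩ :=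
    (isCompact_Icc.inter_left (hgo.isClosed_compl.preimage hcont)).exists_isGreatest
    (⟨w, hgapM _ hwM, le_rfl, hu.1.le⟩ :
      (((fun t => f^[n] (e t)) ⁻¹' (e '' Ioo p q)ᶜ) ∩ Icc w u).Nonempty)
  have hsu : s < u := hs.2.lt_of_ne fun h => hsS (h ▸ hugap)
  have hopen : ∀ t ∈ Ioc s u, f^[n] (e t) ∈ e '' Ioo p q := by
    intro t ht'
    by_contra hcon
    exact absurd (hsmax ⟨hcon, hs.1.trans ht'.1.le, ht'.2⟩) (not_le.2 ht'.1)
  have hclosed : ∀ t ∈ Icc s u, f^[n] (e t) ∈ e '' Icc p q := by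
    intro t ht'
    have h1 : t ∈ closure (Ioc s u) := by rwa [closure_Ioc hsu.ne]
    exact closure_minimal (image_mono Ioo_subset_Icc_self) hcl
      (map_mem_closure (f := fun t => f^[n] (e t)) hcont h1 hopen)
  obtain ⟨g, hgc, hg⟩ := exists_lift he.isEmbedding hf hclosed
  refine ⟨n, by omega, s, u, g, hw.1.trans_le hs.1, hsu, hu.2, hgc, fun t ht' => (hg t ht').2,
    ?_, ?_⟩
  · obtain ⟨z, hz, hzu⟩ := hun
    have h1 := (hg u (right_mem_Icc.2 hsu.le)).2
    rw [← hzu] at h1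
    rwa [← he.injective h1]
  · obtain ⟨hgs, hes⟩ := hg s (left_mem_Icc.2 hsu.le)
    by_contra! hcon
    refine hsS ?_
    change f^[n] (e s) ∈ _
    rw [hes]
    exact ⟨_, ⟨hgs.1.lt_of_ne hcon.1.symm, hgs.2.lt_of_ne hcon.2⟩, rfl⟩

theorem exists_fixed_of_continuousOn {g : ℝ → ℝ} {s t : ℝ} (hg : ContinuousOn g (uIcc s t))
    (hs : g s ≤ s) (ht : t ≤ g t) : ∃ r ∈ uIcc s t, g r = r := by
  obtain ⟨r, hr, hr0⟩ := intermediate_value_uIcc (hg.sub continuousOn_id)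
    (show (0 : ℝ) ∈ uIcc (g s - id s) (g t - id t) from
      mem_uIcc.2 (Or.inl ⟨sub_nonpos.2 hs, sub_nonneg.2 ht⟩))
  exact ⟨r, hr, sub_eq_zero.1 hr0⟩

/-- Periodic points are dense in the gap. In `(a, b)` take two disjoint intervals `K₁ < K₂`, and for
each of them a branch ending between them. A branch on `K₁` starting at `p`, or a branch on `K₂`
starting at `q`, crosses the diagonal. In the remaining case the branch on `K₁` covers `K₂` and
the branch on `K₂` covers `K₁`, and their composition crosses the diagonal. -/
theorem IsGap.exists_mem_periodicPts (hG : IsGap f e M p q) (he : IsOpenEmbedding e)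
    (hf : Continuous f) (ht : IsTransitive f)
    (hpre : ∀ a b, p ≤ a → a < b → b ≤ q → ∃ t ∈ Ioo a b, ∃ n, f^[n] (e t) ∈ M)
    {a b : ℝ} (hpa : p ≤ a) (hab : a < b) (hbq : b ≤ q) :
    ∃ t ∈ Ioo a b, e t ∈ Function.periodicPts f := by
  set k := a + (b - a) / 3 with hk
  set l := b - (b - a) / 3 with hl
  have hkl : k < l := by linarith
  obtain ⟨n, hn, s, u, g, has, hsu, huk, hgc, hg, hgu, hgs⟩ := hG.exists_branch he hf ht hpre hpa
    (show a < k by linarith) (by linarith) (show p ≤ k by linarith) hkl (by linarith)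
  obtain ⟨m, hm, s', u', g', hls', hsu', hub', hgc', hg', hgu', hgs'⟩ :=
    hG.exists_branch he hf ht hpre (show p ≤ l by linarith) (show l < b by linarith) hbq
      (show p ≤ k by linarith) hkl (by linarith)
  rcases hgs with hgs | hgs
  · obtain ⟨r, hr, hfix⟩ := exists_fixed_of_continuousOn (s := s) (t := u)
      (by rwa [uIcc_of_le hsu.le]) (by linarith) (by linarith [hgu.1])
    rw [uIcc_of_le hsu.le] at hr
    exact ⟨r, ⟨has.trans_le hr.1, by linarith [hr.2]⟩, n, hn, (hg r hr).trans (by rw [hfix])⟩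
  rcases hgs' with hgs' | hgs'
  swap
  · obtain ⟨r, hr, hfix⟩ := exists_fixed_of_continuousOn (s := u') (t := s')
      (by rwa [uIcc_of_ge hsu'.le]) (by linarith [hgu'.2]) (by linarith)
    rw [uIcc_of_ge hsu'.le] at hr
    exact ⟨r, ⟨by linarith [hr.1], by linarith [hr.2]⟩, m, hm, (hg' r hr).trans (by rw [hfix])⟩
  have hivt : Icc (g u) (g s) ⊆ g '' Icc s u := intermediate_value_Icc' hsu.le hgc
  obtain ⟨x, hx, hgx⟩ := hivt (⟨by linarith [hgu.2], by linarith⟩ : s' ∈ Icc (g u) (g s))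
  obtain ⟨y, hy, hgy⟩ := hivt (⟨by linarith [hgu.2], by linarith⟩ : u' ∈ Icc (g u) (g s))
  have hxy : uIcc x y ⊆ Icc s u := uIcc_subset_Icc hx hy
  -- Outside `[s', u']` the second branch is extended by its end values `p` and `g' u'`; these lie
  -- outside `[s, u]`, so the extension creates no fixed point of the composition.
  set G := IccExtend hsu'.le ((Icc s' u').domRestrict g') with hGdef
  have hGc : Continuous G := hgc'.domRestrict.Icc_extend'
  have hGin : ∀ t ∈ Icc s' u', G t = g' t := fun t ht' => IccExtend_of_mem _ _ ht'
  obtain ⟨r, hr, hfix⟩ := exists_fixed_of_continuousOn (g := G ∘ g) (s := x) (t := y)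
    (hGc.comp_continuousOn (hgc.mono hxy))
    (by
      rw [Function.comp_apply, hgx, hGin _ (left_mem_Icc.2 hsu'.le), hgs']
      linarith [hx.1])
    (by
      rw [Function.comp_apply, hgy, hGin _ (right_mem_Icc.2 hsu'.le)]
      linarith [hy.2, hgu'.1])
  have hr := hxy hr
  rw [Function.comp_apply] at hfix
  have hgr : g r ∈ Icc s' u' := by
    by_contra hcon
    rcases lt_or_ge (g r) s' with h | h
    · rw [hGdef, IccExtend_of_le_left _ _ h.le, domRestrict_apply, hgs'] at hfix
      linarith [hr.1]
    · have h' : u' < g r := by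
        by_contra h'
        exact hcon ⟨h, not_lt.1 h'⟩
      rw [hGdef, IccExtend_of_right_le _ _ h'.le, domRestrict_apply] at hfix
      linarith [hr.2, hgu'.1]
  refine ⟨r, ⟨by linarith [hr.1], by linarith [hr.2]⟩, m + n, by omega, ?_⟩
  change f^[m + n] (e r) = e r
  rw [Function.iterate_add_apply, hg r hr, hg' _ hgr, ← hGin _ hgr, hfix]

/-- One of the two outer thirds `K`, `L` of the gap is locally eventually onto. By means of a
branch ending in the middle third, every interval covers `K` or `L`. If some interval inside `K`
did not cover `K` and some interval inside `L` did not cover `L`, the first would cover `L`, hence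
the second, hence `K`. -/
theorem IsGap.exists_isLocallyEventuallyOnto (hG : IsGap f e M p q) (he : IsOpenEmbedding e)
    (hf : Continuous f) (ht : IsTransitive f)
    (hpre : ∀ a b, p ≤ a → a < b → b ≤ q → ∃ t ∈ Ioo a b, ∃ n, f^[n] (e t) ∈ M) :
    ∃ a b, a < b ∧ IsLocallyEventuallyOnto f (e '' Ioo a b) := by
  have hpq := hG.lt
  set k := p + (q - p) / 3 with hk
  set l := q - (q - p) / 3 with hl
  have hkl : k < l := by linarith
  have hcov : ∀ U ⊆ e '' Ioo p q, IsOpen U → U.Nonempty →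
      (∃ n, 0 < n ∧ e '' Ioo p k ⊆ f^[n] '' U) ∨ ∃ n, 0 < n ∧ e '' Ioo l q ⊆ f^[n] '' U := by
    intro U hUpq hU hUn
    obtain ⟨_, hxU⟩ := hUn
    obtain ⟨t, htpq, rfl⟩ := hUpq hxU
    obtain ⟨ε, hε, hball⟩ := Metric.isOpen_iff.1 (hU.preimage he.continuous) t hxU
    rw [Real.ball_eq_Ioo] at hball
    obtain ⟨n, hn, s, u, g, has, hsu, hub, hgc, hg, hgu, hgs⟩ := hG.exists_branch he hf ht hpre
      (a := max p (t - ε)) (b := min q (t + ε)) (c := k) (d := l) (le_max_left _ _)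
      (lt_min (max_lt hG.lt (by linarith [htpq.2])) (max_lt (by linarith [htpq.1]) (by linarith)))
      (min_le_left _ _) (by linarith) hkl (by linarith)
    have hUsub : ∀ r ∈ Icc s u, e r ∈ U := fun r hr =>
      hball ⟨(le_max_right p (t - ε)).trans_lt (has.trans_le hr.1),
        (hr.2.trans_lt hub).trans_le (min_le_right q (t + ε))⟩
    rcases hgs with hgs | hgs
    · refine Or.inl ⟨n, hn, ?_⟩
      rintro _ ⟨y, hy, rfl⟩
      obtain ⟨r, hr, rfl⟩ := intermediate_value_Icc hsu.le hgc
        (⟨by linarith [hy.1], by linarith [hy.2, hgu.1]⟩ : y ∈ Icc (g s) (g u))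
      exact ⟨e r, hUsub r hr, hg r hr⟩
    · refine Or.inr ⟨n, hn, ?_⟩
      rintro _ ⟨y, hy, rfl⟩
      obtain ⟨r, hr, rfl⟩ := intermediate_value_Icc' hsu.le hgc
        (⟨by linarith [hy.1, hgu.2], by linarith [hy.2]⟩ : y ∈ Icc (g u) (g s))
      exact ⟨e r, hUsub r hr, hg r hr⟩
  have hKpq : e '' Ioo p k ⊆ e '' Ioo p q := image_mono (Ioo_subset_Ioo_right (by linarith))
  have hLpq : e '' Ioo l q ⊆ e '' Ioo p q := image_mono (Ioo_subset_Ioo_left (by linarith))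
  by_cases hK : ∀ U ⊆ e '' Ioo p k, IsOpen U → U.Nonempty → ∃ n, 0 < n ∧ e '' Ioo p k ⊆ f^[n] '' U
  · exact ⟨p, k, by linarith, he.isOpenMap _ isOpen_Ioo,
      (nonempty_Ioo.2 (by linarith)).image e, hK⟩
  · push Not at hK
    obtain ⟨U, hUK, hU, hUn, hnot⟩ := hK
    obtain ⟨n, hn, hUL⟩ := (hcov U (hUK.trans hKpq) hU hUn).resolve_left
      fun ⟨n, hn, h⟩ => hnot n hn h
    refine ⟨l, q, by linarith, he.isOpenMap _ isOpen_Ioo,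
      (nonempty_Ioo.2 (by linarith)).image e, fun W hWL hW hWn => ?_⟩
    refine (hcov W (hWL.trans hLpq) hW hWn).resolve_left ?_
    rintro ⟨m, hm, hWK⟩
    refine hnot (m + n) (by omega) (hWK.trans ?_)
    rw [Function.iterate_add, image_comp]
    exact image_mono (hWL.trans hUL)

end Gap

/-! ### Spaces with a free interval -/

section FreeIntervalSpace

open Topology

theorem IsFreeInterval.exists_isOpenEmbedding {X : Type*} [TopologicalSpace X] {J : Set X}
    (hJ : IsFreeInterval J) : ∃ e : ℝ → X, IsOpenEmbedding e := by
  obtain ⟨hJo, ⟨φ⟩⟩ := hJ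
  have htarget : (OpenPartialHomeomorph.univBall (1 / 2 : ℝ) (1 / 2)).target = Ioo 0 1 := by
    rw [OpenPartialHomeomorph.univBall_target _ (by norm_num), Real.ball_eq_Ioo]
    norm_num
  let ψ : ℝ ≃ₜ Ioo (0 : ℝ) 1 := (Homeomorph.Set.univ ℝ).symm.trans
    ((Homeomorph.setCongr (OpenPartialHomeomorph.univBall_source _ _).symm).trans
      ((OpenPartialHomeomorph.univBall (1 / 2 : ℝ) (1 / 2)).toHomeomorphSourceTarget.trans
        (Homeomorph.setCongr htarget)))
  exact ⟨fun t => (φ.symm (ψ t) : X),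
    hJo.isOpenEmbedding_subtypeVal.comp (ψ.trans φ.symm).isOpenEmbedding⟩

variable {X : Type*} [TopologicalSpace X] [T2Space X] [Nontrivial X] [CompactSpace X] {f : X → X}
  {e : ℝ → X}

/-- If there is a periodic orbit, it is finite and the gap is chosen off it; otherwise any gap
will do. -/
theorem exists_isGap_of_not_isMinimal (he : IsOpenEmbedding e) (hf : Continuous f)
    (ht : IsTransitive f) (hmin : ¬ IsMinimal f) :
    ∃ M p q, IsGap f e M p q ∧ ((∀ t ∈ Icc p q, e t ∉ Function.periodicPts f) ∨
      ∃ z ∈ Function.periodicPts f, ∀ n, f^[n] z ∉ e '' Icc p q) := by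
  by_cases hz : ∃ z, z ∈ Function.periodicPts f
  · obtain ⟨z, hz⟩ := hz
    have hfin : (range fun n : ℕ => f^[n] z).Finite := by
      refine ((finite_Iio (Function.minimalPeriod f z)).image fun n => f^[n] z).subset ?_
      rintro _ ⟨n, rfl⟩
      exact ⟨n % Function.minimalPeriod f z,
        Nat.mod_lt _ (Function.minimalPeriod_pos_of_mem_periodicPts hz),
        Function.iterate_mod_minimalPeriod_eq⟩
    have hopen : IsOpen (e ⁻¹' (range fun n : ℕ => f^[n] z))ᶜ :=
      (hfin.isClosed.preimage he.continuous).isOpen_compl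
    have hfinR : (e ⁻¹' (range fun n : ℕ => f^[n] z)).Finite := hfin.preimage he.injective.injOn
    obtain ⟨t, htn⟩ := hfinR.infinite_compl.nonempty
    obtain ⟨ε, hε, hball⟩ := Metric.isOpen_iff.1 hopen t htn
    obtain ⟨M, p, q, hp, hq, hG⟩ := exists_isGap he hf ht hmin
      (show t - ε / 2 < t + ε / 2 by linarith)
    refine ⟨M, p, q, hG, Or.inr ⟨z, hz, ?_⟩⟩
    rintro n ⟨r, hr, hrz⟩
    refine hball ?_ (⟨n, hrz.symm⟩ : r ∈ e ⁻¹' (range fun n : ℕ => f^[n] z))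
    rw [Real.ball_eq_Ioo]
    exact ⟨by linarith [hr.1], by linarith [hr.2]⟩
  · obtain ⟨M, p, q, -, -, hG⟩ := exists_isGap he hf ht hmin zero_lt_one
    exact ⟨M, p, q, hG, Or.inl fun t _ h => hz ⟨_, h⟩⟩

end FreeIntervalSpace

end FreeInterval

theorem theorem4p5 {X : Type*} [MetricSpace X] [CompactSpace X]
    (hX : ∃ J : Set X, FreeInterval.IsFreeInterval J)
    (f : X → X) (hf : Continuous f)
    (htrans : FreeInterval.IsTransitive f) (hmin : ¬ FreeInterval.IsMinimal f) :
    FreeInterval.IsRelativelyMixing f ∧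
      ¬ Function.Bijective f ∧
      0 < Dynamics.coverEntropy f Set.univ ∧
      Dense (Function.periodicPts f) := by
  open FreeInterval in
  obtain ⟨J, hJ⟩ := hX
  obtain ⟨e, he⟩ := hJ.exists_isOpenEmbedding
  have : Nontrivial X := he.injective.nontrivial
  obtain ⟨M, p, q, hG, hper⟩ := exists_isGap_of_not_isMinimal he hf htrans hmin
  have hpre : ∀ a b, p ≤ a → a < b → b ≤ q → ∃ t ∈ Set.Ioo a b, ∃ n, f^[n] (e t) ∈ M :=
    fun a b hpa hab hbq => hG.exists_iterate_mem he hf htrans hper hpa hab hbq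
  obtain ⟨a, b, hab, hV⟩ := hG.exists_isLocallyEventuallyOnto he hf htrans hpre
  have hVn : (e '' Set.Ioo a b).Nontrivial :=
    (Set.Ioo_infinite hab).nontrivial.image he.injective
  refine ⟨hV.isRelativelyMixing hf htrans, fun h => hV.not_injective hf hVn h.1,
    hV.coverEntropy_pos hf hVn, ?_⟩
  -- The closure of the set of periodic points is invariant and contains the gap.
  refine dense_iff_closure_eq.2 (htrans.eq_univ_of_mapsTo isClosed_closure
    ((Function.bijOn_periodicPts f).mapsTo.closure hf) ?_)
  refine ((Set.nonempty_Ioo.2 hG.lt).image e).mono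
    (interior_maximal ?_ (he.isOpenMap _ isOpen_Ioo))
  rintro _ ⟨t, ht, rfl⟩
  refine mem_closure_iff.2 fun O hO htO => ?_
  obtain ⟨ε, hε, hball⟩ := Metric.isOpen_iff.1 (hO.preimage he.continuous) t htO
  rw [Real.ball_eq_Ioo] at hball
  obtain ⟨r, hr, hrp⟩ := hG.exists_mem_periodicPts he hf htrans hpre (a := t)
    (b := min q (t + ε)) ht.1.le (lt_min ht.2 (by linarith)) (min_le_left _ _)
  exact ⟨e r, hball ⟨by linarith [hr.1], hr.2.trans_le (min_le_right _ _)⟩, hrp⟩
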